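/- Let $A\subseteq\mathbb{R}^d$ be a nonempty closed convex set, $Y$ a real Banach space, $K\subset Y$ a nonempty closed convex cone, $W$ a nonempty compact Hausdorff space, $f\colon\mathbb{R}^d\times W\to\mathbb{R}$ and $G\colon\mathbb{R}^d\to Y$. Put $F(x)=\max_{\omega\in W}f(x,\omega)$ and consider the problem $$(\mathcal{P})\qquad \min F(x)\quad\text{subject to}\quad G(x)\in K,\ x\in A,$$ with feasible region $\Omega=\{x\in A\mid G(x)\in K\}$. Let $x_*\in\operatorname{int}A$ be a feasible point. Suppose that on some open neighbourhood $U$ of $x_*$ the mapping $G$ is twice continuously Fréchet differentiable, $f(\cdot,\omega)$ is twice differentiable for every $\omega\in W$, and $f$, $\nabla_x f$ and $\nabla^2_{xx}f$ are continuous on $U\times W$. Notation. $T_C(x)$ is the contingent (Bouligand tangent) cone to $C$ at $x$: the set of all $h$ for which there are $a_n>0$, $a_n\to0$, and $h_n\to h$ with $x+a_nh_n\in C$ for all $n$. $F'(x,h)$ denotes the one-sided directional derivative. The set $\Lambda(x_*)$ of Lagrange multipliers consists of all $\lambda\in Y^*$ such that $\langle\lambda,y\rangle\le0$ for all $y\in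 K$, $\langle\lambda,G(x_*)\rangle=0$, and the directional derivative at $x_*$ of $F(\cdot)+\langle\lambda,G(\cdot)\rangle$ in every direction $h\in T_A(x_*)$ is nonnegative. The critical cone is $$C(x_*)=\{h\in T_A(x_*)\mid DG(x_*)h\in T_K(G(x_*)),\ F'(x_*,h)\le0\}.$$ For $\lambda\in\Lambda(x_*)$, the set $\alpha(x_*,\lambda)$ of Danskin–Demyanov multipliers consists of all (positive) Radon measures $\alpha$ on $W$ with $\alpha(W)=1$, $\operatorname{supp}\alpha\subseteq W(x_*)=\{\omega\in W\mid f(x_*,\omega)=F(x_*)\}$, and $$\Big\langle\int_W\nabla_xf(x_*,\omega)\,d\alpha(\omega),h\Big\rangle+\langle\lambda,DG(x_*)h\rangle\ge0\qquad\forall h\in T_A(x_*).$$ The integral Lagrangian is $\mathcal{L}(x,\lambda,\alpha)=\int_Wf(x,\omega)\,d\alpha(\omega)+\langle\lambda,G(x)\rangle$. Theorem. Suppose that $\Lambda(x_*)\ne\emptyset$ and that for every $h\in C(x_*)\setminus\{0\}$ there exist $\lambda\in\Lambda(x_*)$ and $\alpha\in\alpha(x_*,\lambda)$ such that $\langle h,\nabla^2_{xx}\mathcal{L}(x_*,\lambda,\alpha)h\rangle>0$.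 Then $x_*$ is a locally optimal solution of $(\mathcal{P})$ at which the second order growth condition holds: there exist $\rho>0$ and a neighbourhood $O$ of $x_*$ such that $F(x)\ge F(x_*)+\rho|x-x_*|^2$ for all $x\in O\cap\Omega$, where $|\cdot|$ is the Euclidean norm. -/

import Mathlib

open Set Filter Topology MeasureTheory
open scoped Gradient InnerProductSpace

noncomputable section

namespace ConeMinimax

/-- The contingent (Bouligand tangent) cone `T_C(x)` to the set `C` at the point `x`. -/
def contingentCone {X : Type*} [NormedAddCommGroup X] [NormedSpace ℝ X]
    (C : Set X) (x : X) : Set X :=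
  {h | ∃ (a : ℕ → ℝ) (v : ℕ → X), (∀ n, 0 < a n) ∧ Tendsto a atTop (𝓝 0) ∧
    Tendsto v atTop (𝓝 h) ∧ ∀ n, x + a n • v n ∈ C}

/-- The function `φ` has the (one-sided) directional derivative `v` at `x` in the direction `h`:
`v` is the limit of `(φ (x + t h) - φ x) / t` as `t` decreases to `0`. -/
def HasDirDerivAt {X : Type*} [NormedAddCommGroup X] [NormedSpace ℝ X]
    (φ : X → ℝ) (v : ℝ) (x h : X) : Prop :=
  HasDerivWithinAt (fun t : ℝ => φ (x + t • h)) v (Ici 0) 0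

/-- The polar cone `K^*` of `K`. -/
def polarCone {Y : Type*} [NormedAddCommGroup Y] [NormedSpace ℝ Y] (K : Set Y) :
    Set (StrongDual ℝ Y) :=
  {l | ∀ y ∈ K, l y ≤ 0}

/-- The Hessian of `φ` at `x`, i.e. the derivative of the gradient of `φ`. -/
def hessian {d : ℕ} (φ : EuclideanSpace ℝ (Fin d) → ℝ) (x : EuclideanSpace ℝ (Fin d)) :
    EuclideanSpace ℝ (Fin d) →L[ℝ] EuclideanSpace ℝ (Fin d) :=
  fderiv ℝ (∇ φ) x

/-- The objective `F(x) = max_{ω ∈ W} f(x, ω)`. (The supremum is attained wherever `f(x, ·)` is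
continuous, `W` being compact and nonempty.) -/
def maxFun {d : ℕ} {W : Type*} (f : EuclideanSpace ℝ (Fin d) → W → ℝ)
    (x : EuclideanSpace ℝ (Fin d)) : ℝ :=
  ⨆ ω, f x ω

/-- The set `W(x)` of all `ω` with `f(x, ω) = F(x)`. -/
def activeSet {d : ℕ} {W : Type*} (f : EuclideanSpace ℝ (Fin d) → W → ℝ)
    (x : EuclideanSpace ℝ (Fin d)) : Set W :=
  {ω | f x ω = maxFun f x}

/-- The feasible region `Ω = {x ∈ A | G x ∈ K}`. -/
def feasibleSet {d : ℕ} {Y : Type*} (A : Set (EuclideanSpace ℝ (Fin d))) (K : Set Y)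
    (G : EuclideanSpace ℝ (Fin d) → Y) : Set (EuclideanSpace ℝ (Fin d)) :=
  {x | x ∈ A ∧ G x ∈ K}

section Multipliers

variable {d : ℕ} {W Y : Type*} [NormedAddCommGroup Y] [NormedSpace ℝ Y]

/-- The Lagrangian `L(x, λ) = F(x) + ⟨λ, G x⟩`. -/
def lagrangian (f : EuclideanSpace ℝ (Fin d) → W → ℝ) (G : EuclideanSpace ℝ (Fin d) → Y)
    (x : EuclideanSpace ℝ (Fin d)) (l : StrongDual ℝ Y) : ℝ :=
  maxFun f x + l (G x)

/-- The set `Λ(x)` of all Lagrange multipliers at the feasible point `x`. -/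
def lagrangeMultipliers (A : Set (EuclideanSpace ℝ (Fin d))) (K : Set Y)
    (f : EuclideanSpace ℝ (Fin d) → W → ℝ) (G : EuclideanSpace ℝ (Fin d) → Y)
    (x : EuclideanSpace ℝ (Fin d)) : Set (StrongDual ℝ Y) :=
  {l | l ∈ polarCone K ∧ l (G x) = 0 ∧
    ∀ h ∈ contingentCone A x, ∃ v : ℝ, HasDirDerivAt (fun y => lagrangian f G y l) v x h ∧ 0 ≤ v}

/-- The critical cone `C(x) = {h ∈ T_A(x) | DG(x) h ∈ T_K(G x), F'(x, h) ≤ 0}`. -/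
def criticalCone (A : Set (EuclideanSpace ℝ (Fin d))) (K : Set Y)
    (f : EuclideanSpace ℝ (Fin d) → W → ℝ) (G : EuclideanSpace ℝ (Fin d) → Y)
    (x : EuclideanSpace ℝ (Fin d)) : Set (EuclideanSpace ℝ (Fin d)) :=
  {h | h ∈ contingentCone A x ∧ fderiv ℝ G x h ∈ contingentCone K (G x) ∧
    ∃ v : ℝ, HasDirDerivAt (maxFun f) v x h ∧ v ≤ 0}

/-- The integral Lagrangian `𝓛(x, λ, α) = ∫ f(x, ω) dα(ω) + ⟨λ, G x⟩`. -/
def integralLagrangian [MeasurableSpace W] (f : EuclideanSpace ℝ (Fin d) → W → ℝ)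
    (G : EuclideanSpace ℝ (Fin d) → Y) (x : EuclideanSpace ℝ (Fin d)) (l : StrongDual ℝ Y)
    (α : Measure W) : ℝ :=
  (∫ ω, f x ω ∂α) + l (G x)

/-- The set `α(x, λ)` of all Danskin–Demyanov multipliers corresponding to `(x, λ)`: the Radon
measures `α` on `W` with `α(W) = 1` and support in `W(x)` such that
`⟨∫ ∇ₓ f(x, ω) dα(ω), h⟩ + ⟨λ, DG(x) h⟩ ≥ 0` for all `h ∈ T_A(x)`. -/
def danskinDemyanovMultipliers [TopologicalSpace W] [MeasurableSpace W]
    (A : Set (EuclideanSpace ℝ (Fin d))) (f : EuclideanSpace ℝ (Fin d) → W → ℝ)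
    (G : EuclideanSpace ℝ (Fin d) → Y) (x : EuclideanSpace ℝ (Fin d)) (l : StrongDual ℝ Y) :
    Set (Measure W) :=
  {α | α.Regular ∧ α univ = 1 ∧ α.support ⊆ activeSet f x ∧
    ∀ h ∈ contingentCone A x,
      0 ≤ ⟪∫ ω, (∇ fun y => f y ω) x ∂α, h⟫_ℝ + l (fderiv ℝ G x h)}

end Multipliers

/-- The second order growth condition at a point `x` for the minimisation of `F` over `Ω`. -/
def SecondOrderGrowth {d : ℕ} (F : EuclideanSpace ℝ (Fin d) → ℝ)
    (Ω : Set (EuclideanSpace ℝ (Fin d))) (x : EuclideanSpace ℝ (Fin d)) : Prop :=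
  ∃ ρ : ℝ, 0 < ρ ∧ ∃ O ∈ 𝓝 x, ∀ y ∈ O ∩ Ω, F x + ρ * ‖y - x‖ ^ 2 ≤ F y

end ConeMinimax

end

open Set Filter Topology MeasureTheory
open scoped Gradient InnerProductSpace

/-! The proof is by contradiction and compactness. If quadratic growth fails, there are feasible
points `x₀ + t n • u n` with unit `u n → h ≠ 0`, `t n → 0` and values below `F x₀ + o(t n ^ 2)`
(`exists_seq_of_not_secondOrderGrowth`). To first order this makes `h` critical: feasibility gives
the condition on `DG(x₀) h`, and `HasDirDerivAt.le_zero_of_seq` gives `F'(x₀, h) ≤ 0`.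

Now take the multipliers `l`, `α` belonging to this `h`. On feasible points near `x₀` the integral
Lagrangian lies below `F`, because `α` averages and `l` is polar to `K`. At `x₀` the two agree,
because `α` lives on the active set and `l (G x₀) = 0`. Its gradient is nonnegative in every
direction since `x₀` is interior to `A`, so Taylor's formula bounds `F` below by a quadratic form
(`quadratic_lower_bound`). That form is positive at `h`, which contradicts the upper bound after
division by `t n ^ 2`. Only one limit direction occurs, so the multipliers may depend on `h`. -/

namespace ConeMinimax

/-! ### Parametric integrals, Taylor expansion, tangent directions. -/

section Calculus

variable {E : Type*} [NormedAddCommGroup E]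

/-- A jointly continuous function on `U × W`, with `W` compact, is bounded near each point of `U`,
uniformly in the second variable. -/
theorem exists_closedBall_bound [ProperSpace E] {W V : Type*} [TopologicalSpace W] [CompactSpace W]
    [NormedAddCommGroup V] {U : Set E} (hU : IsOpen U) {x₀ : E} (hx₀ : x₀ ∈ U) {g : E → W → V}
    (hg : ContinuousOn (fun p : E × W => g p.1 p.2) (U ×ˢ univ)) :
    ∃ r > 0, Metric.closedBall x₀ r ⊆ U ∧
      ∃ C : ℝ, ∀ x ∈ Metric.closedBall x₀ r, ∀ ω, ‖g x ω‖ ≤ C := by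
  obtain ⟨r, hr, hrU⟩ := Metric.nhds_basis_closedBall.mem_iff.1 (hU.mem_nhds hx₀)
  obtain ⟨C, hC⟩ := ((isCompact_closedBall x₀ r).prod isCompact_univ).exists_bound_of_continuousOn
    (hg.mono (prod_mono hrU (subset_refl (univ : Set W))))
  exact ⟨r, hr, hrU, C, fun x hx ω => hC (x, ω) ⟨hx, mem_univ ω⟩⟩

theorem continuous_slice {W V : Type*} [TopologicalSpace W] [TopologicalSpace V]
    {U : Set E} {x : E} (hx : x ∈ U) {g : E → W → V}
    (hg : ContinuousOn (fun p : E × W => g p.1 p.2) (U ×ˢ univ)) : Continuous (g x) := by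
  rw [← continuousOn_univ]
  exact hg.comp (f := fun ω => (x, ω)) (by fun_prop) fun ω _ => ⟨hx, mem_univ ω⟩

theorem integrable_of_continuous {W V : Type*} [TopologicalSpace W] [CompactSpace W]
    [MeasurableSpace W] [BorelSpace W] [NormedAddCommGroup V] {g : W → V} (hg : Continuous g)
    (α : Measure W) [IsFiniteMeasure α] : Integrable g α :=
  hg.integrable_of_hasCompactSupport (HasCompactSupport.of_compactSpace g)

/-- Differentiation under the integral sign over a compact parameter space. -/
theorem hasFDerivAt_integral_of_continuousOn [NormedSpace ℝ E] [ProperSpace E] {W V : Type*}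
    [TopologicalSpace W] [CompactSpace W] [MeasurableSpace W] [BorelSpace W]
    [NormedAddCommGroup V] [NormedSpace ℝ V] {U : Set E} (hU : IsOpen U) {x₀ : E} (hx₀ : x₀ ∈ U)
    {g : E → W → V} {g' : E → W → E →L[ℝ] V}
    (hg : ContinuousOn (fun p : E × W => g p.1 p.2) (U ×ˢ univ))
    (hg' : ContinuousOn (fun p : E × W => g' p.1 p.2) (U ×ˢ univ))
    (hd : ∀ ω, ∀ x ∈ U, HasFDerivAt (fun y => g y ω) (g' x ω) x)
    (α : Measure W) [IsFiniteMeasure α] :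
    HasFDerivAt (fun x => ∫ ω, g x ω ∂α) (∫ ω, g' x₀ ω ∂α) x₀ := by
  obtain ⟨r, hr, hrU, C, hC⟩ := exists_closedBall_bound hU hx₀ hg'
  refine hasFDerivAt_integral_of_dominated_of_fderiv_le (bound := fun _ => C)
    (Metric.closedBall_mem_nhds x₀ hr) ?_ (integrable_of_continuous (continuous_slice hx₀ hg) α)
    (integrable_of_continuous (continuous_slice hx₀ hg') α).aestronglyMeasurable
    (ae_of_all _ fun ω x hx => hC x hx ω) (integrable_const C)
    (ae_of_all _ fun ω x hx => hd ω x (hrU hx))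
  filter_upwards [hU.mem_nhds hx₀] with x hx
  exact (integrable_of_continuous (continuous_slice hx hg) α).aestronglyMeasurable

/-- Second order Taylor expansion with Peano remainder. -/
theorem taylor_two_isLittleO [InnerProductSpace ℝ E] [CompleteSpace E] {g : E → ℝ} {x₀ : E}
    (hg : ∀ᶠ x in 𝓝 x₀, DifferentiableAt ℝ g x) (hg' : DifferentiableAt ℝ (∇ g) x₀) :
    (fun v => g (x₀ + v) - g x₀ - ⟪∇ g x₀, v⟫_ℝ - 1 / 2 * ⟪v, fderiv ℝ (∇ g) x₀ v⟫_ℝ)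
      =o[𝓝 0] fun v => ‖v‖ ^ 2 := by
  set H := fderiv ℝ (∇ g) x₀ with hH
  rw [Asymptotics.isLittleO_iff]
  intro ε hε
  have h1 := (Asymptotics.isLittleO_iff.1 (hasFDerivAt_iff_isLittleO_nhds_zero.1
    hg'.hasFDerivAt)) hε
  have h2 : ∀ᶠ v in 𝓝 (0 : E), DifferentiableAt ℝ g (x₀ + v) :=
    (show Tendsto (fun v : E => x₀ + v) (𝓝 0) (𝓝 x₀) from
      (by fun_prop : Continuous fun v : E => x₀ + v).tendsto' 0 x₀ (add_zero x₀)).eventually hg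
  obtain ⟨r, hr, hrv⟩ := Metric.eventually_nhds_iff.1 (h1.and h2)
  filter_upwards [Metric.ball_mem_nhds (0 : E) hr] with v hv
  have hseg : ∀ t ∈ Icc (0 : ℝ) 1, dist (t • v) 0 < r := fun t ht => by
    rw [mem_ball_zero_iff] at hv
    rw [dist_zero_right, norm_smul, Real.norm_of_nonneg ht.1]
    exact (mul_le_of_le_one_left (norm_nonneg v) ht.2).trans_lt hv
  -- Along the segment, `g` minus its quadratic Taylor polynomial has as derivative the first order
  -- error of `∇ g` paired with `v`. That is at most `ε * ‖v‖ ^ 2`, so the mean value inequality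
  -- suffices and no continuity of the Hessian is needed.
  have hderiv : ∀ t ∈ Icc (0 : ℝ) 1, HasDerivWithinAt
      (fun t : ℝ => g (x₀ + t • v) - t * ⟪∇ g x₀, v⟫_ℝ - t ^ 2 / 2 * ⟪v, H v⟫_ℝ)
      (⟪∇ g (x₀ + t • v) - ∇ g x₀ - H (t • v), v⟫_ℝ) (Icc 0 1) t := by
    intro t ht
    have hline : HasDerivAt (fun t : ℝ => x₀ + t • v) v t := by
      simpa using ((hasDerivAt_id t).smul_const v).const_add x₀
    have hcomp := ((hrv (hseg t ht)).2.hasFDerivAt).comp_hasDerivAt t hline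
    have hsq : HasDerivAt (fun t : ℝ => t ^ 2 / 2) t t := by
      simpa using ((hasDerivAt_id t).pow 2).div_const 2
    refine (((hcomp.sub ((hasDerivAt_id t).mul_const ⟪∇ g x₀, v⟫_ℝ)).sub
      (hsq.mul_const ⟪v, H v⟫_ℝ)).congr_deriv ?_).hasDerivWithinAt
    rw [inner_sub_left, inner_sub_left, inner_gradient_left, map_smul, inner_smul_left,
      real_inner_comm v (H v)]
    simp
  have hbound := norm_image_sub_le_of_norm_deriv_le_segment_01' hderiv (C := ε * ‖v‖ ^ 2) ?_
  · rw [norm_pow, norm_norm]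
    refine (le_of_eq (congrArg norm ?_)).trans hbound
    simp only [one_smul, zero_smul, add_zero]
    ring
  · intro t ht
    have ht' : t ∈ Icc (0 : ℝ) 1 := ⟨ht.1, ht.2.le⟩
    calc ‖⟪∇ g (x₀ + t • v) - ∇ g x₀ - H (t • v), v⟫_ℝ‖
        ≤ ‖∇ g (x₀ + t • v) - ∇ g x₀ - H (t • v)‖ * ‖v‖ := norm_inner_le_norm _ _
      _ ≤ ε * ‖t • v‖ * ‖v‖ := by gcongr; exact (hrv (hseg t ht')).1
      _ ≤ ε * ‖v‖ * ‖v‖ := by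
        gcongr
        rw [norm_smul, Real.norm_of_nonneg ht.1]
        exact mul_le_of_le_one_left (norm_nonneg v) ht.2.le
      _ = ε * ‖v‖ ^ 2 := by ring

/-- Every vector is tangent to a set at an interior point. -/
theorem mem_contingentCone_of_mem_interior [NormedSpace ℝ E] {A : Set E} {x : E}
    (hx : x ∈ interior A) (h : E) : h ∈ contingentCone A x := by
  have hlim : Tendsto (fun t : ℝ => x + t • h) (𝓝[>] 0) (𝓝 x) :=
    ((by fun_prop : Continuous fun t : ℝ => x + t • h).tendsto' 0 x (by simp)).mono_left
      nhdsWithin_le_nhds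
  have hev : ∀ᶠ t in 𝓝[>] (0 : ℝ), 0 < t ∧ x + t • h ∈ A :=
    (eventually_mem_nhdsWithin (a := (0 : ℝ)) (s := Ioi 0)).and
      (hlim.eventually (mem_interior_iff_mem_nhds.1 hx))
  obtain ⟨u, hu, hmem⟩ := exists_seq_forall_of_frequently hev.frequently
  exact ⟨u, fun _ => h, fun n => (hmem n).1, hu.mono_right nhdsWithin_le_nhds,
    tendsto_const_nhds, fun n => (hmem n).2⟩

end Calculus

/-! ### Local Lipschitz continuity of the maximum function. -/

section MaxFunction

variable {d : ℕ} {W : Type*} [TopologicalSpace W] [CompactSpace W]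
  {f : EuclideanSpace ℝ (Fin d) → W → ℝ} {U : Set (EuclideanSpace ℝ (Fin d))}
  {x x₀ : EuclideanSpace ℝ (Fin d)}

theorem le_maxFun (hf : Continuous (f x)) (ω : W) : f x ω ≤ maxFun f x :=
  le_ciSup (isCompact_range hf).bddAbove ω

/-- The maximum function is Lipschitz near every point of `U`. -/
theorem maxFun_lipschitz_near [Nonempty W] (hU : IsOpen U) (hx₀ : x₀ ∈ U)
    (hf : ContinuousOn (fun p : EuclideanSpace ℝ (Fin d) × W => f p.1 p.2) (U ×ˢ univ))
    (hd : ∀ ω, ∀ x ∈ U, DifferentiableAt ℝ (fun y => f y ω) x)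
    (hgrad : ContinuousOn
      (fun p : EuclideanSpace ℝ (Fin d) × W => (∇ fun y => f y p.2) p.1) (U ×ˢ univ)) :
    ∃ C : ℝ, ∃ O ∈ 𝓝 x₀, ∀ x ∈ O, ∀ y ∈ O, maxFun f x ≤ maxFun f y + C * ‖x - y‖ := by
  obtain ⟨r, hr, hrU, C, hC⟩ := exists_closedBall_bound hU hx₀
    (g := fun x ω => (∇ fun y => f y ω) x) hgrad
  refine ⟨C, Metric.closedBall x₀ r, Metric.closedBall_mem_nhds x₀ hr, fun x hx y hy => ?_⟩
  -- The gradient bound `C` does not depend on `ω`, so the mean value estimate for each `f · ω`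
  -- survives the supremum.
  refine ciSup_le fun ω => ?_
  have h := (convex_closedBall x₀ r).norm_image_sub_le_of_norm_fderiv_le (𝕜 := ℝ)
    (f := fun z => f z ω) (fun z hz => hd ω z (hrU hz))
    (fun z hz => by
      rw [← toDual_gradient, LinearIsometryEquiv.norm_map]
      exact hC z hz ω) hy hx
  have h' := (Real.le_norm_self _).trans h
  have hle := le_maxFun (continuous_slice (hrU hy) hf) ω
  linarith

end MaxFunction

/-! ### The integral Lagrangian as a smooth minorant. -/

section Lagrangian

/-- Regularity makes the support conull, so the integrand equals its maximum almost everywhere. -/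
theorem integral_eq_maxFun_of_support_subset {d : ℕ} {W : Type*} [TopologicalSpace W]
    [T2Space W] [MeasurableSpace W] [OpensMeasurableSpace W]
    {f : EuclideanSpace ℝ (Fin d) → W → ℝ} {x : EuclideanSpace ℝ (Fin d)} {α : Measure W} (hreg : α.Regular)
    (huniv : α univ = 1) (hsupp : α.support ⊆ activeSet f x) :
    ∫ ω, f x ω ∂α = maxFun f x := by
  have hae : (fun ω => f x ω) =ᵐ[α] fun _ => maxFun f x := by
    filter_upwards [Measure.support_mem_ae_of_regular (μ := α)] with ω hω using hsupp hω
  rw [integral_congr_ae hae, integral_const, Measure.real, huniv]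
  simp

variable {d : ℕ} {W Y : Type*} [TopologicalSpace W] [CompactSpace W]
  [MeasurableSpace W] [BorelSpace W] [NormedAddCommGroup Y] [NormedSpace ℝ Y]
  {f : EuclideanSpace ℝ (Fin d) → W → ℝ} {G : EuclideanSpace ℝ (Fin d) → Y}
  {U : Set (EuclideanSpace ℝ (Fin d))} {x x₀ : EuclideanSpace ℝ (Fin d)}

/-- The formula holds at every point of `U`, so it can be differentiated once more; the Riesz
isomorphism turns the constraint term into a vector. -/
theorem hasGradientAt_integralLagrangian (hU : IsOpen U) (hx : x ∈ U)
    (hf : ContinuousOn (fun p : EuclideanSpace ℝ (Fin d) × W => f p.1 p.2) (U ×ˢ univ))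
    (hd : ∀ ω, ∀ x ∈ U, DifferentiableAt ℝ (fun y => f y ω) x)
    (hgrad : ContinuousOn
      (fun p : EuclideanSpace ℝ (Fin d) × W => (∇ fun y => f y p.2) p.1) (U ×ˢ univ))
    (hG : ContDiffOn ℝ 2 G U) (l : StrongDual ℝ Y) (α : Measure W) [IsFiniteMeasure α] :
    HasGradientAt (fun x => integralLagrangian f G x l α)
      ((∫ ω, (∇ fun y => f y ω) x ∂α) +
        (InnerProductSpace.toDual ℝ _).symm (l ∘L fderiv ℝ G x)) x := by
  rw [hasGradientAt_iff_hasFDerivAt, map_add, LinearIsometryEquiv.apply_symm_apply]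
  have hint := hasFDerivAt_integral_of_continuousOn hU hx hf
    (g' := fun x ω => InnerProductSpace.toDual ℝ _ ((∇ fun y => f y ω) x))
    ((InnerProductSpace.toDual ℝ _).continuous.comp_continuousOn hgrad)
    (fun ω x hx => (hd ω x hx).hasGradientAt.hasFDerivAt) α
  have hcomm : ∫ ω, InnerProductSpace.toDual ℝ _ ((∇ fun y => f y ω) x) ∂α =
      InnerProductSpace.toDual ℝ _ (∫ ω, (∇ fun y => f y ω) x ∂α) :=
    (InnerProductSpace.toDual ℝ (EuclideanSpace ℝ (Fin d))).toLinearIsometry.toContinuousLinearMap.integral_comp_comm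
      (integrable_of_continuous (continuous_slice (g := fun x ω => (∇ fun y => f y ω) x) hx hgrad) α)
  rw [hcomm] at hint
  exact hint.add (l.hasFDerivAt.comp x
    ((hG.contDiffAt (hU.mem_nhds hx)).differentiableAt (by norm_num)).hasFDerivAt)

theorem differentiableAt_gradient_integralLagrangian (hU : IsOpen U) (hx : x ∈ U)
    (hf : ContinuousOn (fun p : EuclideanSpace ℝ (Fin d) × W => f p.1 p.2) (U ×ˢ univ))
    (hd : ∀ ω, ∀ x ∈ U, DifferentiableAt ℝ (fun y => f y ω) x)
    (hgrad : ContinuousOn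
      (fun p : EuclideanSpace ℝ (Fin d) × W => (∇ fun y => f y p.2) p.1) (U ×ˢ univ))
    (hd2 : ∀ ω, ∀ x ∈ U, DifferentiableAt ℝ (∇ fun y => f y ω) x)
    (hhess : ContinuousOn
      (fun p : EuclideanSpace ℝ (Fin d) × W => hessian (fun y => f y p.2) p.1) (U ×ˢ univ))
    (hG : ContDiffOn ℝ 2 G U) (l : StrongDual ℝ Y) (α : Measure W) [IsFiniteMeasure α] :
    DifferentiableAt ℝ (∇ fun x => integralLagrangian f G x l α) x := by
  have hint := hasFDerivAt_integral_of_continuousOn hU hx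
    (g := fun x ω => (∇ fun y => f y ω) x) (g' := fun x ω => hessian (fun y => f y ω) x)
    hgrad hhess (fun ω x hx => (hd2 ω x hx).hasFDerivAt) α
  have hG' : DifferentiableAt ℝ (fderiv ℝ G) x :=
    ((hG.contDiffAt (hU.mem_nhds hx)).fderiv_right (m := 1) (by norm_num)).differentiableAt
      (by norm_num)
  have hdual : DifferentiableAt ℝ
      (fun x => (InnerProductSpace.toDual ℝ _).symm (l ∘L fderiv ℝ G x)) x :=
    (InnerProductSpace.toDual ℝ (EuclideanSpace ℝ (Fin d))).symm.differentiable.differentiableAt.comp x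
      ((differentiableAt_const l).clm_comp hG')
  refine (hint.differentiableAt.add hdual).congr_of_eventuallyEq ?_
  filter_upwards [hU.mem_nhds hx] with y hy
  exact (hasGradientAt_integralLagrangian hU hy hf hd hgrad hG l α).gradient

theorem integral_le_maxFun {α : Measure W} [IsProbabilityMeasure α]
    (hf : Continuous (f x)) : ∫ ω, f x ω ∂α ≤ maxFun f x := by
  simpa using integral_mono (integrable_of_continuous hf α) (integrable_const (maxFun f x))
    (le_maxFun hf)

/-- The integral Lagrangian minorises the objective on the feasible set, up to second order. -/
theorem quadratic_lower_bound [T2Space W]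
    {A : Set (EuclideanSpace ℝ (Fin d))} {K : Set Y} (hU : IsOpen U) (hx₀ : x₀ ∈ U)
    (hf : ContinuousOn (fun p : EuclideanSpace ℝ (Fin d) × W => f p.1 p.2) (U ×ˢ univ))
    (hd : ∀ ω, ∀ x ∈ U, DifferentiableAt ℝ (fun y => f y ω) x)
    (hgrad : ContinuousOn
      (fun p : EuclideanSpace ℝ (Fin d) × W => (∇ fun y => f y p.2) p.1) (U ×ˢ univ))
    (hd2 : ∀ ω, ∀ x ∈ U, DifferentiableAt ℝ (∇ fun y => f y ω) x)
    (hhess : ContinuousOn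
      (fun p : EuclideanSpace ℝ (Fin d) × W => hessian (fun y => f y p.2) p.1) (U ×ˢ univ))
    (hG : ContDiffOn ℝ 2 G U) (hint : x₀ ∈ interior A)
    {l : StrongDual ℝ Y} (hl : l ∈ lagrangeMultipliers A K f G x₀)
    {α : Measure W} (hα : α ∈ danskinDemyanovMultipliers A f G x₀ l) {ε : ℝ} (hε : 0 < ε) :
    ∀ᶠ v in 𝓝 (0 : EuclideanSpace ℝ (Fin d)), G (x₀ + v) ∈ K →
      maxFun f x₀ + 1 / 2 * ⟪v, hessian (fun x => integralLagrangian f G x l α) x₀ v⟫_ℝ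
        - ε * ‖v‖ ^ 2 ≤ maxFun f (x₀ + v) := by
  obtain ⟨hreg, huniv, hsupp, hstat⟩ := hα
  have : IsProbabilityMeasure α := ⟨huniv⟩
  have hL := fun x hx => hasGradientAt_integralLagrangian hU (x := x) hx hf hd hgrad hG l α
  have htaylor := taylor_two_isLittleO
    (eventually_of_mem (hU.mem_nhds hx₀) fun x hx => (hL x hx).differentiableAt)
    (differentiableAt_gradient_integralLagrangian hU hx₀ hf hd hgrad hd2 hhess hG l α)
  have hUv : ∀ᶠ v in 𝓝 (0 : EuclideanSpace ℝ (Fin d)), x₀ + v ∈ U :=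
    (continuous_const_add x₀).tendsto' 0 x₀ (add_zero x₀) (hU.mem_nhds hx₀)
  filter_upwards [Asymptotics.isLittleO_iff.1 htaylor hε, hUv] with v hv hvU hvK
  -- At an interior point of `A` every `v` is tangent, so the multiplier inequality applies to the
  -- displacement itself.
  have hgrad_nonneg : 0 ≤ ⟪∇ (fun x => integralLagrangian f G x l α) x₀, v⟫_ℝ := by
    rw [(hL x₀ hx₀).gradient, inner_add_left, InnerProductSpace.toDual_symm_apply]
    exact hstat v (mem_contingentCone_of_mem_interior hint v)
  rw [norm_pow, norm_norm] at hv
  have hv' := (abs_le.1 hv).1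
  have hbase : integralLagrangian f G x₀ l α = maxFun f x₀ := by
    rw [integralLagrangian, hl.2.1, integral_eq_maxFun_of_support_subset hreg huniv hsupp,
      add_zero]
  have hup : integralLagrangian f G (x₀ + v) l α ≤ maxFun f (x₀ + v) := by
    have h1 := integral_le_maxFun (α := α) (continuous_slice hvU hf)
    have h2 := hl.1 _ hvK
    rw [integralLagrangian]
    linarith
  rw [hbase] at hv'
  unfold hessian
  linarith

end Lagrangian

/-! ### Directional derivatives along converging directions. -/

section DirectionalDerivative

variable {E : Type*} [NormedAddCommGroup E] [NormedSpace ℝ E]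

theorem HasDirDerivAt.tendsto_slope {φ : E → ℝ} {v : ℝ} {x h : E} (hφ : HasDirDerivAt φ v x h)
    {t : ℕ → ℝ} (ht : ∀ n, 0 < t n) (ht0 : Tendsto t atTop (𝓝 0)) :
    Tendsto (fun n => (φ (x + t n • h) - φ x) / t n) atTop (𝓝 v) := by
  have hs := hasDerivWithinAt_iff_tendsto_slope.1 hφ
  have ht' : Tendsto t atTop (𝓝[Ici 0 \ {0}] 0) :=
    tendsto_nhdsWithin_iff.2 ⟨ht0, Eventually.of_forall fun n => ⟨(ht n).le, (ht n).ne'⟩⟩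
  refine (hs.comp ht').congr fun n => ?_
  simp [slope_def_field]

/-- For locally Lipschitz functions, the directional derivative is also the limit of difference
quotients along converging directions. -/
theorem HasDirDerivAt.le_zero_of_seq {φ : E → ℝ} {v : ℝ} {x h : E} (hφ : HasDirDerivAt φ v x h)
    {C : ℝ} {O : Set E} (hO : O ∈ 𝓝 x) (hlip : ∀ y ∈ O, ∀ z ∈ O, φ y ≤ φ z + C * ‖y - z‖)
    {t e : ℕ → ℝ} {u : ℕ → E} (ht : ∀ n, 0 < t n) (ht0 : Tendsto t atTop (𝓝 0))
    (hu : Tendsto u atTop (𝓝 h)) (he : Tendsto e atTop (𝓝 0))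
    (hle : ∀ n, φ (x + t n • u n) ≤ φ x + t n * e n) : v ≤ 0 := by
  have h1 : Tendsto (fun n => x + t n • h) atTop (𝓝 x) := by
    simpa using (ht0.smul_const h).const_add x
  have h2 : Tendsto (fun n => x + t n • u n) atTop (𝓝 x) := by
    simpa using (ht0.smul hu).const_add x
  -- The second term is the Lipschitz cost, per unit of `t n`, of replacing `u n` by `h`.
  have hlim : Tendsto (fun n => e n + C * ‖h - u n‖) atTop (𝓝 0) := by
    simpa using he.add ((hu.const_sub h).norm.const_mul C)
  refine le_of_tendsto_of_tendsto (hφ.tendsto_slope ht ht0) hlim ?_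
  filter_upwards [h1 hO, h2 hO] with n hn1 hn2
  have h3 := hlip _ hn1 _ hn2
  rw [add_sub_add_left_eq_sub, ← smul_sub, norm_smul, Real.norm_of_nonneg (ht n).le] at h3
  have h4 := hle n
  rw [div_le_iff₀ (ht n)]
  linarith

end DirectionalDerivative

/-! ### Extraction of a limit direction. -/

section Sequences

variable {d : ℕ}

/-- If quadratic growth fails, then it fails along a sequence with converging directions. -/
theorem exists_seq_of_not_secondOrderGrowth {F : EuclideanSpace ℝ (Fin d) → ℝ}
    {Ω : Set (EuclideanSpace ℝ (Fin d))} {x₀ : EuclideanSpace ℝ (Fin d)}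
    (hF : ¬ SecondOrderGrowth F Ω x₀) :
    ∃ (t e : ℕ → ℝ) (u : ℕ → EuclideanSpace ℝ (Fin d)) (h : EuclideanSpace ℝ (Fin d)),
      h ≠ 0 ∧ (∀ n, 0 < t n) ∧ Tendsto t atTop (𝓝 0) ∧ Tendsto e atTop (𝓝 0) ∧
      Tendsto u atTop (𝓝 h) ∧ (∀ n, ‖u n‖ = 1) ∧ (∀ n, x₀ + t n • u n ∈ Ω) ∧
      ∀ n, F (x₀ + t n • u n) < F x₀ + e n * t n ^ 2 := by
  -- Growth is denied with `1 / (n + 1)` as both the constant `ρ` and the radius of the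
  -- neighbourhood.
  have hex : ∀ n : ℕ, ∃ y ∈ Metric.ball x₀ (1 / ((n : ℝ) + 1)) ∩ Ω,
      F y < F x₀ + 1 / ((n : ℝ) + 1) * ‖y - x₀‖ ^ 2 := by
    intro n
    by_contra! hcon
    exact hF ⟨_, Nat.one_div_pos_of_nat, _, Metric.ball_mem_nhds x₀ Nat.one_div_pos_of_nat, hcon⟩
  choose y hy hFy using hex
  -- The strict inequality in `hFy` excludes `y n = x₀`, so directions can be normalised.
  have hpos : ∀ n, 0 < ‖y n - x₀‖ := fun n => by
    rw [norm_pos_iff, sub_ne_zero]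
    intro heq
    simpa [heq] using hFy n
  have hmem : ∀ n, ‖y n - x₀‖⁻¹ • (y n - x₀) ∈ Metric.sphere (0 : EuclideanSpace ℝ (Fin d)) 1 :=
    fun n => by
      rw [mem_sphere_zero_iff_norm, norm_smul, norm_inv, norm_norm, inv_mul_cancel₀ (hpos n).ne']
  obtain ⟨h, hh, k, hk, hlim⟩ := (isCompact_sphere _ _).tendsto_subseq hmem
  have hy_eq : ∀ n, x₀ + ‖y n - x₀‖ • ‖y n - x₀‖⁻¹ • (y n - x₀) = y n := fun n => by
    rw [smul_inv_smul₀ (hpos n).ne', add_sub_cancel]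
  have he : Tendsto (fun n : ℕ => 1 / ((n : ℝ) + 1)) atTop (𝓝 0) :=
    tendsto_one_div_add_atTop_nhds_zero_nat
  have ht : Tendsto (fun n => ‖y n - x₀‖) atTop (𝓝 0) :=
    squeeze_zero (fun n => norm_nonneg _) (fun n => (mem_ball_iff_norm.1 (hy n).1).le) he
  refine ⟨fun n => ‖y (k n) - x₀‖, fun n => 1 / ((k n : ℝ) + 1),
    fun n => ‖y (k n) - x₀‖⁻¹ • (y (k n) - x₀), h, ne_zero_of_mem_unit_sphere ⟨h, hh⟩,
    fun n => hpos _, ht.comp hk.tendsto_atTop, he.comp hk.tendsto_atTop, hlim,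
    fun n => mem_sphere_zero_iff_norm.1 (hmem _), fun n => ?_, fun n => ?_⟩
  · simp only [hy_eq]
    exact (hy _).2
  · simp only [hy_eq]
    exact hFy _

end Sequences

end ConeMinimax

/-! ### Second order sufficiency. -/

theorem mainTheorem12 {d : ℕ} {W Y : Type*}
    [TopologicalSpace W] [CompactSpace W] [T2Space W] [Nonempty W]
    [MeasurableSpace W] [BorelSpace W]
    [NormedAddCommGroup Y] [NormedSpace ℝ Y] [CompleteSpace Y]
    (A : Set (EuclideanSpace ℝ (Fin d))) (hA_closed : IsClosed A) (hA_convex : Convex ℝ A)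
    (K : Set Y) (hK_nonempty : K.Nonempty) (hK_closed : IsClosed K) (hK_convex : Convex ℝ K)
    (hK_cone : ∀ t : ℝ, 0 < t → ∀ y ∈ K, t • y ∈ K)
    (f : EuclideanSpace ℝ (Fin d) → W → ℝ) (G : EuclideanSpace ℝ (Fin d) → Y)
    (x₀ : EuclideanSpace ℝ (Fin d))
    (U : Set (EuclideanSpace ℝ (Fin d))) (hU_open : IsOpen U) (hU_mem : x₀ ∈ U)
    -- `f` is twice differentiable in `x` on `U`; `f`, `∇ₓ f`, `∇²ₓₓ f` are continuous on `U × W`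
    (hf_cont : ContinuousOn (fun p : EuclideanSpace ℝ (Fin d) × W => f p.1 p.2)
      (U ×ˢ Set.univ))
    (hf_diff : ∀ ω, ∀ x ∈ U, DifferentiableAt ℝ (fun y => f y ω) x)
    (hf_grad : ContinuousOn
      (fun p : EuclideanSpace ℝ (Fin d) × W => (∇ fun y => f y p.2) p.1) (U ×ˢ Set.univ))
    (hf_diff2 : ∀ ω, ∀ x ∈ U, DifferentiableAt ℝ (∇ fun y => f y ω) x)
    (hf_hess : ContinuousOn
      (fun p : EuclideanSpace ℝ (Fin d) × W => ConeMinimax.hessian (fun y => f y p.2) p.1)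
      (U ×ˢ Set.univ))
    (hG : ContDiffOn ℝ 2 G U)
    (hx₀_int : x₀ ∈ interior A)
    (hx₀_feas : x₀ ∈ ConeMinimax.feasibleSet A K G)
    (hΛ : (ConeMinimax.lagrangeMultipliers A K f G x₀).Nonempty)
    (hsuff : ∀ h ∈ ConeMinimax.criticalCone A K f G x₀, h ≠ 0 →
      ∃ l ∈ ConeMinimax.lagrangeMultipliers A K f G x₀,
        ∃ α ∈ ConeMinimax.danskinDemyanovMultipliers A f G x₀ l,
          0 < ⟪h, ConeMinimax.hessian
            (fun x => ConeMinimax.integralLagrangian f G x l α) x₀ h⟫_ℝ) :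
    IsLocalMinOn (ConeMinimax.maxFun f) (ConeMinimax.feasibleSet A K G) x₀ ∧
      ConeMinimax.SecondOrderGrowth (ConeMinimax.maxFun f)
        (ConeMinimax.feasibleSet A K G) x₀ := by
  have hgrowth : ConeMinimax.SecondOrderGrowth (ConeMinimax.maxFun f)
      (ConeMinimax.feasibleSet A K G) x₀ := by
    by_contra hcon
    obtain ⟨t, e, u, h, hh, ht, ht0, he0, hu, hu1, hfeas, hlt⟩ :=
      ConeMinimax.exists_seq_of_not_secondOrderGrowth hcon
    have htu : Tendsto (fun n => t n • u n) atTop (𝓝 0) := by simpa using ht0.smul hu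
    have hGx : HasFDerivAt G (fderiv ℝ G x₀) x₀ :=
      ((hG.contDiffAt (hU_open.mem_nhds hU_mem)).differentiableAt (by norm_num)).hasFDerivAt
    have hcrit : h ∈ ConeMinimax.criticalCone A K f G x₀ := by
      refine ⟨ConeMinimax.mem_contingentCone_of_mem_interior hx₀_int h, ?_, ?_⟩
      -- The difference quotients of `G` tend to `DG(x₀) h`, and the points they reach are the
      -- values `G (x₀ + t n • u n)` in `K`.
      · refine ⟨t, fun n => (t n)⁻¹ • (G (x₀ + t n • u n) - G x₀), ht, ht0, ?_, fun n => ?_⟩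
        · refine (hasFDerivWithinAt_univ.2 hGx).lim htu (Eventually.of_forall fun _ => mem_univ _)
            (hu.congr fun n => ?_)
          rw [inv_smul_smul₀ (ht n).ne']
        · rw [smul_inv_smul₀ (ht n).ne', add_sub_cancel]
          exact (hfeas n).2
      -- Any multiplier serves here: its Lagrangian has a directional derivative, and subtracting
      -- that of `l ∘ G` shows that `F'(x₀, h)` exists. The sign comes from the sequence.
      · obtain ⟨l, hl⟩ := hΛ
        obtain ⟨w, hw, -⟩ := hl.2.2 h (ConeMinimax.mem_contingentCone_of_mem_interior hx₀_int h)
        have hlG : HasDerivWithinAt (fun s : ℝ => l (G (x₀ + s • h))) (l (fderiv ℝ G x₀ h))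
            (Ici 0) 0 := by
          have hline : HasDerivAt (fun s : ℝ => x₀ + s • h) h 0 := by
            simpa using ((hasDerivAt_id (0 : ℝ)).smul_const h).const_add x₀
          have hGx' : HasFDerivAt G (fderiv ℝ G x₀) (x₀ + (0 : ℝ) • h) := by simpa using hGx
          exact (l.hasFDerivAt.comp_hasDerivAt (0 : ℝ)
            (hGx'.comp_hasDerivAt (0 : ℝ) hline)).hasDerivWithinAt
        have hF : ConeMinimax.HasDirDerivAt (ConeMinimax.maxFun f) (w - l (fderiv ℝ G x₀ h))
            x₀ h :=
          (HasDerivWithinAt.sub hw hlG).congr_of_mem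
            (fun s _ => by simp [ConeMinimax.lagrangian]) self_mem_Ici
        obtain ⟨C, O, hO, hlip⟩ :=
          ConeMinimax.maxFun_lipschitz_near hU_open hU_mem hf_cont hf_diff hf_grad
        -- The error `e n * t n ^ 2` is rewritten as `t n * (e n * t n)`, a first order error with
        -- vanishing coefficient.
        refine ⟨_, hF, hF.le_zero_of_seq (e := fun n => e n * t n) hO hlip ht ht0 hu
          (by simpa using he0.mul ht0) fun n => ?_⟩
        exact (hlt n).le.trans_eq (by ring)
    obtain ⟨l, hl, α, hα, hpos⟩ := hsuff h hcrit hh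
    set H := ConeMinimax.hessian (fun x => ConeMinimax.integralLagrangian f G x l α) x₀
    set q := ⟪h, H h⟫_ℝ
    -- Division by `t n ^ 2` will give `1 / 2 * ⟪u n, H (u n)⟫ - e n < ε`, whose left side tends to
    -- `q / 2`. Any positive `ε` below `q / 2` yields a contradiction, and `q / 4` is one.
    have hlow := htu.eventually (ConeMinimax.quadratic_lower_bound hU_open hU_mem hf_cont hf_diff
      hf_grad hf_diff2 hf_hess hG hx₀_int hl hα (ε := q / 4) (by positivity))
    have hq : Tendsto (fun n => 1 / 2 * ⟪u n, H (u n)⟫_ℝ - e n) atTop (𝓝 (1 / 2 * q)) := by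
      simpa only [sub_zero, Function.comp_def] using ((hu.inner ((H.continuous.tendsto h).comp hu)).const_mul (1 / 2)).sub he0
    obtain ⟨n, hn, hqn⟩ := (hlow.and (hq.eventually_const_lt
      (show q / 4 < 1 / 2 * q by linarith))).exists
    have hn' := (hn (hfeas n).2).trans_lt (hlt n)
    rw [map_smul, inner_smul_left, inner_smul_right, norm_smul, hu1 n,
      Real.norm_of_nonneg (ht n).le] at hn'
    simp only [conj_trivial, mul_one] at hn'
    nlinarith [mul_pos (pow_pos (ht n) 2) (sub_pos.2 hqn)]
  refine ⟨?_, hgrowth⟩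
  obtain ⟨ρ, hρ, O, hO, hle⟩ := hgrowth
  filter_upwards [inter_mem (mem_nhdsWithin_of_mem_nhds hO) self_mem_nhdsWithin] with y hy
  exact (le_add_of_nonneg_right (by positivity)).trans (hle y hy)
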